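/- Let $N\ge 1$, $s\in(0,1)$, $m>0$, $R>0$, and let $C_R=B_R(0)\times(0,1)\subset\mathbb{R}^N\times\mathbb{R}$, with points written $(x,y)$. Let $H^1_m(C_R,y^{1-2s})$ be the space of functions $v$ on $C_R$ with a weak gradient $\nabla v$ such that $\iint_{C_R}y^{1-2s}(|\nabla v|^2+m^2v^2)\,dx\,dy<\infty$. Let $v\in H^1_m(C_R,y^{1-2s})\cap C(\overline{C_R})$ satisfy $$-\operatorname{div}(y^{1-2s}\nabla v)+m^2y^{1-2s}v\ge 0\quad\text{weakly in } C_R,$$ that is, $\iint_{C_R}y^{1-2s}(\nabla v\cdot\nabla\varphi+m^2v\varphi)\,dx\,dy\ge 0$ for every nonnegative $\varphi\in C^1_c(C_R)$. Suppose that $v>0$ in $C_R$ and $v(0,0)=0$. Then $$\limsup_{y\to0^+}\left(-y^{1-2s}\,\frac{v(0,y)}{y}\right)<0,$$ where the value $-\infty$ is allowed. If moreover the partial derivative $v_y$ exists in $C_R$ and $y^{1-2s}v_y$ extends to a continuous function on $\overline{C_R}$, then the weighted normal derivative $$\frac{\partial v}{\partial\nu^{1-2s}}(0,0):=-\lim_{y\to0^+}y^{1-2s}v_y(0,y)$$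 exists and is negative. -/

import Mathlib

open MeasureTheory Filter Topology Set

noncomputable section

/-- Points `(x, y)` of `ℝ^N × ℝ`, with `x` in the Euclidean space `ℝ^N`. -/
abbrev ExtSpace (N : ℕ) : Type := EuclideanSpace ℝ (Fin N) × ℝ

/-- The open cylinder `C_R = B_R(0) × (0,1)`. -/
def hopfCylinder (N : ℕ) (R : ℝ) : Set (ExtSpace N) :=
  Metric.ball (0 : EuclideanSpace ℝ (Fin N)) R ×ˢ Ioo (0 : ℝ) 1

/-- `φ` is of class `C^n` with compact support contained in `Ω`. -/
structure IsTestFunction {N : ℕ} (n : ℕ∞) (Ω : Set (ExtSpace N)) (φ : ExtSpace N → ℝ) : Prop where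
  contDiff : ContDiff ℝ n φ
  hasCompactSupport : HasCompactSupport φ
  tsupport_subset : tsupport φ ⊆ Ω

/-- `G` is a distributional gradient of `v` in `Ω`: for every direction `e`, the derivative of `v`
along `e` is the Euclidean product `G · e`, in the sense of distributions. -/
structure HasWeakGradient {N : ℕ} (Ω : Set (ExtSpace N)) (v : ExtSpace N → ℝ)
    (G : ExtSpace N → ExtSpace N) : Prop where
  locallyIntegrableOn : LocallyIntegrableOn v Ω
  locallyIntegrableOn_grad : LocallyIntegrableOn G Ω
  integral_eq : ∀ φ : ExtSpace N → ℝ, IsTestFunction ⊤ Ω φ → ∀ e : ExtSpace N,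
    ∫ z in Ω, v z * fderiv ℝ φ z e =
      - ∫ z in Ω, (inner ℝ (G z).1 e.1 + (G z).2 * e.2) * φ z

/-- `v` belongs to the weighted Sobolev space `H^1_m(Ω, y^{1-2s})`, with weak gradient `G`:
the integral of `y^{1-2s} (|∇v|² + m² v²)` over `Ω` is finite. -/
structure HasWeightedH1Gradient {N : ℕ} (s m : ℝ) (Ω : Set (ExtSpace N)) (v : ExtSpace N → ℝ)
    (G : ExtSpace N → ExtSpace N) : Prop where
  hasWeakGradient : HasWeakGradient Ω v G
  integrableOn_energy : IntegrableOn
    (fun z => z.2 ^ (1 - 2 * s) * (‖(G z).1‖ ^ 2 + (G z).2 ^ 2 + m ^ 2 * v z ^ 2)) Ω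

/-- `v ∈ H^1_m(Ω, y^{1-2s})` satisfies `-div(y^{1-2s} ∇v) + m² y^{1-2s} v ≥ 0` weakly in `Ω`.
For a differentiable `φ`, `fderiv ℝ φ z (G z)` is the Euclidean product `∇v · ∇φ` at `z`. -/
def IsWeakSupersolution {N : ℕ} (s m : ℝ) (Ω : Set (ExtSpace N)) (v : ExtSpace N → ℝ) : Prop :=
  ∃ G : ExtSpace N → ExtSpace N, HasWeightedH1Gradient s m Ω v G ∧
    ∀ φ : ExtSpace N → ℝ, IsTestFunction 1 Ω φ → (∀ z, 0 ≤ φ z) →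
      0 ≤ ∫ z in Ω, z.2 ^ (1 - 2 * s) * (fderiv ℝ φ z (G z) + m ^ 2 * v z * φ z)

/-- The partial derivative `v_y`. -/
def partialY {N : ℕ} (v : ExtSpace N → ℝ) (z : ExtSpace N) : ℝ :=
  deriv (fun t : ℝ => v (z.1, t)) z.2

/-- `y^{1-2s} v_y ∈ C(closure Ω)`: the partial derivative `v_y` exists in `Ω`, and `y^{1-2s} v_y`
extends to a continuous function on the closure of `Ω`. -/
def WeightedPartialYContinuous {N : ℕ} (s : ℝ) (Ω : Set (ExtSpace N)) (v : ExtSpace N → ℝ) : Prop :=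
  (∀ z ∈ Ω, DifferentiableAt ℝ (fun t : ℝ => v (z.1, t)) z.2) ∧
    ∃ g : ExtSpace N → ℝ, ContinuousOn g (closure Ω) ∧
      ∀ z ∈ Ω, g z = z.2 ^ (1 - 2 * s) * partialY v z

/-- The weighted conormal derivative `-lim_{y → 0⁺} y^{1-2s} v_y(x,y)` at `(x,0)` exists and
equals `L`. -/
def HasWeightedNormalDeriv {N : ℕ} (s : ℝ) (v : ExtSpace N → ℝ) (x : EuclideanSpace ℝ (Fin N))
    (L : ℝ) : Prop :=
  Tendsto (fun y : ℝ => -(y ^ (1 - 2 * s) * partialY v (x, y))) (𝓝[>] 0) (𝓝 L)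

end

/-! Near the origin `v` is compared with the barrier `y^{2s} (1 - B|x|²) + A y^{2s+1}`. The power
`y^{2s}` is annihilated by `div(y^{1-2s} ∇ ·)` and has the critical growth. The term `-B|x|²` makes
the barrier nonpositive on the lateral side, and the term in `A` pays for it and for the mass, so
that the barrier is a subsolution in a thin cylinder. On the lid of that cylinder `v` is bounded
below by a positive constant, so a small multiple of the barrier lies below `v` on the whole
boundary. Comparison gives `ε y^{2s} ≤ v(0,y)` for small `y`
(`IsWeakSupersolution.exists_mul_rpow_le`). Multiplying by `y^{1-2s}/y` bounds the limsup by `-ε`;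
Cauchy's mean value theorem against `y^{2s}` transfers the bound to `v_y`.

The technical core is the comparison principle `IsWeakSupersolution.le_of_subsolution`. One wants to
test with a truncation of `W - v`, but test functions are `C¹` and `v` has only a weak gradient. In
the test function alone, `v` is therefore replaced by a mollification, and the positive part is
squared. The gradient term is then a square up to the `L²` distance between the weak gradient and
its mollification, while the mass term, with `m > 0`, yields a fixed gain where `W - v` is large. -/

open scoped ENNReal Convolution

/-! ### Mollification in `L²` -/

section Mollification

variable {E F : Type*} [NormedAddCommGroup E] [NormedSpace ℝ E] [FiniteDimensional ℝ E]
  [MeasurableSpace E] [BorelSpace E] {μ : Measure E} [μ.IsAddHaarMeasure]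
  [NormedAddCommGroup F]

/-- Translations act continuously on `L²`. -/
theorem exists_lintegral_translate_sub_sq_le {f : E → F} (hf : MemLp f 2 μ) {ε : ℝ≥0∞}
    (hε : ε ≠ 0) :
    ∃ δ > 0, ∀ t : E, ‖t‖ ≤ δ → ∫⁻ z, ‖f (z - t) - f z‖ₑ ^ 2 ∂μ ≤ ε := by
  have : Fact ((2 : ℝ≥0∞) ≠ ∞) := ⟨by simp⟩
  have : ProperSpace E := FiniteDimensional.proper ℝ E
  let g : Lp F 2 μ := hf.toLp f
  -- Translations form a continuous action on `Lp` for finite exponent; `mk (-t)` acts by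
  -- precomposition with `z ↦ -t + z`.
  have hc : Continuous (fun t : E => (DomAddAct.mk (-t)) +ᵥ g) := by
    have h1 : Continuous (fun t : E => DomAddAct.mk (-t)) :=
      DomAddAct.continuous_mk.comp continuous_neg
    exact h1.vadd continuous_const
  have h0 : Tendsto (fun t : E => edist ((DomAddAct.mk (-t)) +ᵥ g) g) (𝓝 0) (𝓝 0) := by
    have := (hc.edist (continuous_const (y := g))).tendsto 0
    simpa using this
  have hpos : 0 < ε ^ (1/2 : ℝ) := by
    rw [pos_iff_ne_zero]; simp [hε]
  obtain ⟨δ, hδ, H⟩ := Metric.eventually_nhds_iff.1 (h0.eventually (eventually_lt_nhds hpos))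
  refine ⟨δ / 2, by positivity, fun t ht => ?_⟩
  have h2 := (H (y := t) (by rw [dist_zero_right]; linarith)).le
  rw [Lp.edist_def] at h2
  have hmp : MeasurePreserving (fun z : E => -t + z) μ μ := measurePreserving_add_left μ (-t)
  have h3 : ⇑((DomAddAct.mk (-t)) +ᵥ g) - ⇑g =ᵐ[μ] fun z => f (z - t) - f z := by
    have e1 : ⇑((DomAddAct.mk (-t)) +ᵥ g) =ᵐ[μ] ⇑g ∘ (fun z : E => -t + z) :=
      DomAddAct.vadd_Lp_ae_eq _ _
    have e2 : ⇑g =ᵐ[μ] f := hf.coeFn_toLp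
    have e3 := hmp.quasiMeasurePreserving.ae_eq_comp e2
    filter_upwards [e1, e2, e3] with z a b c
    rw [Pi.sub_apply, a, b, c, Function.comp_apply, neg_add_eq_sub]
  rw [eLpNorm_congr_ae h3, eLpNorm_eq_lintegral_rpow_enorm_toReal (by simp) (by simp)] at h2
  have h4 := (ENNReal.rpow_le_rpow_iff (z := 1/2) (by norm_num)).1 (by simpa using h2)
  simpa using h4

variable [NormedSpace ℝ F] [CompleteSpace F]

/-- Mollifications converge in `L²`. -/
theorem exists_lintegral_convolution_sub_sq_le {f : E → F} (hf : MemLp f 2 μ) {ε : ℝ≥0∞}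
    (hε : ε ≠ 0) :
    ∃ δ > 0, ∀ φ : ContDiffBump (0 : E), φ.rOut ≤ δ →
      ∫⁻ z, ‖(φ.normed μ ⋆[ContinuousLinearMap.lsmul ℝ ℝ, μ] f) z - f z‖ₑ ^ 2 ∂μ ≤ ε := by
  obtain ⟨δ, hδ, H⟩ := exists_lintegral_translate_sub_sq_le hf hε
  refine ⟨δ, hδ, fun φ hφ => ?_⟩
  have hloc : LocallyIntegrable f μ := hf.locallyIntegrable (by norm_num)
  let ρ : E → ℝ≥0∞ := fun t => ENNReal.ofReal (φ.normed μ t)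
  have hρm : Measurable ρ := φ.continuous_normed.measurable.ennreal_ofReal
  have hρ1 : ∫⁻ t, ρ t ∂μ = 1 := by
    rw [← ofReal_integral_eq_lintegral_ofReal φ.integrable_normed
      (Eventually.of_forall φ.nonneg_normed), φ.integral_normed, ENNReal.ofReal_one]
  have hqmp : Measure.QuasiMeasurePreserving (fun p : E × E => p.1 - p.2) (μ.prod μ) μ :=
    quasiMeasurePreserving_sub μ μ
  have hprod : AEStronglyMeasurable (fun p : E × E => f (p.1 - p.2) - f p.1) (μ.prod μ) :=
    (hf.1.comp_quasiMeasurePreserving hqmp).sub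
      (hf.1.comp_quasiMeasurePreserving Measure.quasiMeasurePreserving_fst)
  have hpt : ∀ z, ‖(φ.normed μ ⋆[ContinuousLinearMap.lsmul ℝ ℝ, μ] f) z - f z‖ₑ ^ 2 ≤
      ∫⁻ t, ρ t * ‖f (z - t) - f z‖ₑ ^ 2 ∂μ := by
    intro z
    have hmz : AEStronglyMeasurable (fun t => f (z - t) - f z) μ :=
      (hf.1.comp_measurePreserving (Measure.measurePreserving_sub_left μ z)).sub
        aestronglyMeasurable_const
    have hex : ConvolutionExistsAt (φ.normed μ) f z (ContinuousLinearMap.lsmul ℝ ℝ) μ :=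
      (φ.hasCompactSupport_normed.convolutionExists_left _ φ.continuous_normed hloc) z
    have e : (φ.normed μ ⋆[ContinuousLinearMap.lsmul ℝ ℝ, μ] f) z - f z =
        ∫ t, φ.normed μ t • (f (z - t) - f z) ∂μ := by
      simp_rw [smul_sub]
      have hex' : Integrable (fun t => φ.normed μ t • f (z - t)) μ := hex.integrable
      rw [integral_sub hex' (φ.integrable_normed.smul_const _), integral_smul_const,
        φ.integral_normed, one_smul]
      rfl
    have h1 : ‖(φ.normed μ ⋆[ContinuousLinearMap.lsmul ℝ ℝ, μ] f) z - f z‖ₑ ≤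
        ∫⁻ t, ρ t * ‖f (z - t) - f z‖ₑ ∂μ := by
      rw [e]
      refine (enorm_integral_le_lintegral_enorm _).trans (lintegral_mono fun t => ?_)
      simp only [enorm_smul, ρ]
      rw [Real.enorm_of_nonneg (φ.nonneg_normed t)]
    -- Jensen's inequality: `ρ dμ` is a probability measure, so the `L¹` norm is at most the `L²`
    -- norm.
    let ν := μ.withDensity ρ
    have : IsProbabilityMeasure ν := ⟨by simp [ν, hρ1]⟩
    have hmν : AEStronglyMeasurable (fun t => f (z - t) - f z) ν :=
      hmz.mono_ac (withDensity_absolutelyContinuous _ _)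
    have h2 := eLpNorm_le_eLpNorm_of_exponent_le (p := 1) (q := 2) (by norm_num) hmν
    rw [eLpNorm_one_eq_lintegral_enorm,
      eLpNorm_eq_lintegral_rpow_enorm_toReal (by simp) (by simp)] at h2
    rw [lintegral_withDensity_eq_lintegral_mul₀ hρm.aemeasurable hmz.enorm] at h2
    have h5 : AEMeasurable (fun t => ‖f (z - t) - f z‖ₑ ^ (2 : ℝ≥0∞).toReal) μ :=
      hmz.enorm.pow_const _
    rw [lintegral_withDensity_eq_lintegral_mul₀ hρm.aemeasurable h5] at h2
    have h6 := pow_le_pow_left' (h1.trans h2) 2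
    rw [← ENNReal.rpow_natCast, ← ENNReal.rpow_natCast, ← ENNReal.rpow_mul] at h6
    simpa using h6
  calc ∫⁻ z, ‖(φ.normed μ ⋆[ContinuousLinearMap.lsmul ℝ ℝ, μ] f) z - f z‖ₑ ^ 2 ∂μ
      ≤ ∫⁻ z, ∫⁻ t, ρ t * ‖f (z - t) - f z‖ₑ ^ 2 ∂μ ∂μ := lintegral_mono hpt
    _ = ∫⁻ t, ∫⁻ z, ρ t * ‖f (z - t) - f z‖ₑ ^ 2 ∂μ ∂μ := by
        refine lintegral_lintegral_swap ?_
        exact (hρm.comp measurable_snd).aemeasurable.mul (hprod.enorm.pow_const 2)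
    _ ≤ ∫⁻ t, ρ t * ε ∂μ := by
        refine lintegral_mono fun t => ?_
        rw [lintegral_const_mul' _ _ ENNReal.ofReal_ne_top]
        by_cases ht : ‖t‖ ≤ δ
        · gcongr
          exact H t ht
        · have : φ.normed μ t = 0 := by
            have : t ∉ Function.support (φ.normed μ) := by
              rw [φ.support_normed_eq, Metric.mem_ball, dist_zero_right]
              intro h; linarith
            simpa using this
          simp [ρ, this]
    _ = ε := by rw [lintegral_mul_const _ hρm, hρ1, one_mul]

end Mollification

/-! ### Euclidean product versus the product norm -/

/-- The Euclidean product on `ℝ^N × ℝ`. -/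
noncomputable def ExtSpace.dot {N : ℕ} (p q : ExtSpace N) : ℝ := inner ℝ p.1 q.1 + p.2 * q.2

namespace ExtSpace

variable {N : ℕ}

theorem dot_sub_left (p q r : ExtSpace N) : dot (p - q) r = dot p r - dot q r := by
  simp [dot, inner_sub_left]; ring

/-- The norm of a product space is the maximum of the two norms, only equivalent to the Euclidean
one; hence the factor 2. -/
theorem dot_self_le (p : ExtSpace N) : dot p p ≤ 2 * ‖p‖ ^ 2 := by
  have h1 : ‖p.1‖ ^ 2 ≤ ‖p‖ ^ 2 := by gcongr; exact norm_fst_le p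
  have h2 : p.2 * p.2 ≤ ‖p‖ ^ 2 := by
    have : ‖p.2‖ ^ 2 ≤ ‖p‖ ^ 2 := by gcongr; exact norm_snd_le p
    rw [Real.norm_eq_abs, sq_abs] at this
    linarith
  rw [dot, real_inner_self_eq_norm_sq]
  linarith

theorem norm_sq_le (p : ExtSpace N) : ‖p‖ ^ 2 ≤ ‖p.1‖ ^ 2 + p.2 ^ 2 := by
  rw [Prod.norm_def]
  rcases max_cases ‖p.1‖ ‖p.2‖ with h | h
  · rw [h.1]; nlinarith [sq_nonneg p.2]
  · rw [h.1, Real.norm_eq_abs, sq_abs]; nlinarith [sq_nonneg ‖p.1‖]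

/-- A one-sided perturbation bound for the nonnegative form `dot`. -/
theorem neg_le_dot (p q : ExtSpace N) : -(‖q - p‖ ^ 2 / 2) ≤ dot p q := by
  have h := dot_self_le (q - p)
  -- Polarization at the midpoint: `p · q = |(p + q)/2|² - |q - p|²/4`.
  have key : 0 ≤ dot (p + (1 / 2 : ℝ) • (q - p)) (p + (1 / 2 : ℝ) • (q - p)) := by
    rw [dot, real_inner_self_eq_norm_sq]
    exact add_nonneg (sq_nonneg _) (mul_self_nonneg _)
  have e : dot (p + (1 / 2 : ℝ) • (q - p)) (p + (1 / 2 : ℝ) • (q - p)) =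
      dot p q + dot (q - p) (q - p) / 4 := by
    simp only [dot, Prod.fst_add, Prod.snd_add, Prod.smul_fst, Prod.smul_snd, Prod.fst_sub,
      Prod.snd_sub, inner_add_left, inner_add_right, inner_sub_left, inner_sub_right,
      real_inner_smul_left, real_inner_smul_right, smul_eq_mul, real_inner_comm p.1 q.1]
    ring
  linarith

/-- The Euclidean product against a fixed vector, as a continuous linear form. -/
noncomputable def dotCLM (e : ExtSpace N) : ExtSpace N →L[ℝ] ℝ :=
  (innerSL ℝ e.1).comp (ContinuousLinearMap.fst ℝ _ _) +
    e.2 • ContinuousLinearMap.snd ℝ _ _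

theorem dotCLM_apply (e p : ExtSpace N) : dotCLM e p = dot p e := by
  simp [dotCLM, dot, real_inner_comm, mul_comm]

end ExtSpace

/-! ### Mollification and weak gradients -/

instance {N : ℕ} : (volume : Measure (ExtSpace N)).IsAddHaarMeasure :=
  Measure.prod.instIsAddHaarMeasure volume volume

/-- The mollification of `f` by the normalized bump function `ρ`. -/
noncomputable def mollify {N : ℕ} {F : Type*} [NormedAddCommGroup F] [NormedSpace ℝ F]
    (ρ : ContDiffBump (0 : ExtSpace N)) (f : ExtSpace N → F) : ExtSpace N → F :=
  ρ.normed volume ⋆[ContinuousLinearMap.lsmul ℝ ℝ, volume] f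

theorem contDiff_mollify {N : ℕ} {ρ : ContDiffBump (0 : ExtSpace N)} {f : ExtSpace N → ℝ}
    (hf : LocallyIntegrable f) : ContDiff ℝ 1 (mollify ρ f) :=
  ρ.hasCompactSupport_normed.contDiff_convolution_left (n := 1) _ ρ.contDiff_normed hf

/-- Mollification commutes with the weak gradient, away from the boundary. -/
theorem HasWeakGradient.fderiv_mollify {N : ℕ} {Ω K : Set (ExtSpace N)} {v : ExtSpace N → ℝ}
    {G : ExtSpace N → ExtSpace N} (h : HasWeakGradient Ω v G) (hΩ : MeasurableSet Ω)
    (hv : IntegrableOn v Ω) (hK : IsCompact K) (hKΩ : K ⊆ Ω) {ρ : ContDiffBump (0 : ExtSpace N)}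
    {z : ExtSpace N} (hz : Metric.closedBall z ρ.rOut ⊆ K) (e : ExtSpace N) :
    fderiv ℝ (mollify ρ (Ω.indicator v)) z e =
      ExtSpace.dot (mollify ρ (K.indicator G) z) e := by
  have hvloc : LocallyIntegrable (Ω.indicator v) := (hv.integrable_indicator hΩ).locallyIntegrable
  have hGloc : LocallyIntegrable (K.indicator G) :=
    ((h.locallyIntegrableOn_grad.integrableOn_compact_subset hKΩ hK).integrable_indicator
      hK.measurableSet).locallyIntegrable
  have hcd : ContDiff ℝ (⊤ : ℕ∞) (ρ.normed volume) := ρ.contDiff_normed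
  have hcd1 : ContDiff ℝ 1 (ρ.normed volume) := ρ.contDiff_normed
  have hρd : Differentiable ℝ (ρ.normed (volume : Measure (ExtSpace N))) :=
    hcd1.differentiable one_ne_zero
  -- Testing the weak gradient with the reflected kernel moves the derivative from the kernel to
  -- `v`. Its support lies in `K`, so only the values of `G` on `K` enter.
  let ψ : ExtSpace N → ℝ := fun t => ρ.normed volume (z - t)
  have hψsupp : tsupport ψ ⊆ Metric.closedBall z ρ.rOut := by
    refine closure_minimal (fun t ht => ?_) Metric.isClosed_closedBall
    have : z - t ∈ Function.support (ρ.normed (volume : Measure (ExtSpace N))) := ht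
    rw [ρ.support_normed_eq, mem_ball_zero_iff] at this
    rw [Metric.mem_closedBall, dist_comm, dist_eq_norm]
    exact this.le
  have hψ : IsTestFunction ⊤ Ω ψ :=
    ⟨hcd.comp (contDiff_const.sub contDiff_id),
      HasCompactSupport.of_support_subset_isCompact (isCompact_closedBall z ρ.rOut)
        ((subset_tsupport _).trans hψsupp), hψsupp.trans (hz.trans hKΩ)⟩
  have hψd : ∀ t, fderiv ℝ ψ t e = - fderiv ℝ (ρ.normed volume) (z - t) e := by
    intro t
    have h1 : HasFDerivAt (fun t : ExtSpace N => z - t) (-(ContinuousLinearMap.id ℝ _)) t := by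
      simpa using (hasFDerivAt_id t).const_sub z
    have h2 := (hρd (z - t)).hasFDerivAt.comp t h1
    have h3 : fderiv ℝ ψ t = _ := h2.fderiv
    rw [h3]; simp
  have hfd := ρ.hasCompactSupport_normed.hasFDerivAt_convolution_left
    (ContinuousLinearMap.lsmul ℝ ℝ) hcd1 hvloc z
  have hex := ((ρ.hasCompactSupport_normed (μ := volume)).fderiv ℝ).convolutionExists_left
    ((ContinuousLinearMap.lsmul ℝ ℝ : ℝ →L[ℝ] ℝ →L[ℝ] ℝ).precompL (ExtSpace N))
    (hcd1.continuous_fderiv one_ne_zero) hvloc z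
  have hexG := ρ.hasCompactSupport_normed.convolutionExists_left
    (ContinuousLinearMap.lsmul ℝ ℝ : ℝ →L[ℝ] ExtSpace N →L[ℝ] ExtSpace N)
    hcd1.continuous hGloc z
  rw [show fderiv ℝ (mollify ρ (Ω.indicator v)) z = _ from hfd.fderiv, convolution_eq_swap,
    ContinuousLinearMap.integral_apply hex.integrable_swap]
  have lhs : ∀ t, (((ContinuousLinearMap.lsmul ℝ ℝ : ℝ →L[ℝ] ℝ →L[ℝ] ℝ).precompL (ExtSpace N))
      (fderiv ℝ (ρ.normed volume) (z - t)) (Ω.indicator v t)) e =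
      - Ω.indicator (fun t => v t * fderiv ℝ ψ t e) t := by
    intro t
    rw [ContinuousLinearMap.precompL_apply]
    by_cases ht : t ∈ Ω
    · simp [ht, hψd, mul_comm]
    · simp [ht]
  rw [integral_congr_ae (Eventually.of_forall lhs), integral_neg, integral_indicator hΩ,
    h.integral_eq ψ hψ e, neg_neg, mollify, convolution_eq_swap, ← ExtSpace.dotCLM_apply,
    ← ContinuousLinearMap.integral_comp_comm _ hexG.integrable_swap, ← integral_indicator hΩ]
  refine integral_congr_ae (Eventually.of_forall fun t => ?_)
  simp only [ContinuousLinearMap.lsmul_apply, map_smul, ExtSpace.dotCLM_apply, smul_eq_mul]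
  by_cases ht : t ∈ K
  · rw [indicator_of_mem (hKΩ ht), indicator_of_mem ht, mul_comm]
    rfl
  · have : ψ t = 0 := image_eq_zero_of_notMem_tsupport fun h' => ht (hz (hψsupp h'))
    by_cases ht' : t ∈ Ω
    · rw [indicator_of_mem ht', this, show ρ.normed volume (z - t) = 0 from this]; simp
    · rw [indicator_of_notMem ht', show ρ.normed volume (z - t) = 0 from this]; simp

/-! ### Truncated test functions and local estimates -/

/-- The positive part itself is not `C¹`, but its square has the continuous derivative `2 t⁺`. At
`0` the bound by `t²` forces a zero derivative. -/
theorem hasDerivAt_max_zero_sq (t : ℝ) :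
    HasDerivAt (fun t : ℝ => (max t 0) ^ 2) (2 * max t 0) t := by
  rcases lt_trichotomy t 0 with h | h | h
  · have : (fun t : ℝ => (max t 0) ^ 2) =ᶠ[𝓝 t] fun _ => 0 := by
      filter_upwards [eventually_lt_nhds h] with x hx
      simp [max_eq_right hx.le]
    rw [max_eq_right h.le, mul_zero]
    exact (hasDerivAt_const t (0 : ℝ)).congr_of_eventuallyEq this
  · subst h
    rw [max_self, mul_zero]
    have h1 : (fun t : ℝ => (max t 0) ^ 2) =O[𝓝 0] fun t : ℝ => (t - 0) ^ 2 := by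
      refine Asymptotics.IsBigO.of_norm_le fun t => ?_
      rw [sub_zero, Real.norm_of_nonneg (by positivity), ← sq_abs t]
      gcongr
      exact max_le (le_abs_self t) (abs_nonneg t)
    have h2 := Asymptotics.IsBigO.hasFDerivAt (𝕜 := ℝ) (n := 2) (x₀ := (0 : ℝ))
      (f := fun t : ℝ => (max t 0) ^ 2)
      (h1.trans (Asymptotics.IsBigO.of_norm_le fun t => by simp)) (by norm_num)
    have h3 := h2.hasDerivAt
    simpa using h3
  · have : (fun t : ℝ => (max t 0) ^ 2) =ᶠ[𝓝 t] fun t => t ^ 2 := by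
      filter_upwards [eventually_gt_nhds h] with x hx
      rw [max_eq_left hx.le]
    rw [max_eq_left h.le]
    simpa using (hasDerivAt_pow 2 t).congr_of_eventuallyEq this

theorem contDiff_max_zero_sq : ContDiff ℝ 1 (fun t : ℝ => (max t 0) ^ 2) := by
  rw [contDiff_one_iff_deriv]
  refine ⟨fun t => (hasDerivAt_max_zero_sq t).differentiableAt, ?_⟩
  rw [show deriv (fun t : ℝ => (max t 0) ^ 2) = fun t => 2 * max t 0 from
    funext fun t => (hasDerivAt_max_zero_sq t).deriv]
  fun_prop

/-- Mollifications of a continuous function converge uniformly on compact sets. -/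
theorem exists_abs_mollify_sub_le {N : ℕ} {Ω K : Set (ExtSpace N)} {v : ExtSpace N → ℝ}
    (hΩ : IsOpen Ω) (hv : IntegrableOn v Ω) (hvc : ContinuousOn v Ω) (hK : IsCompact K)
    (hKΩ : K ⊆ Ω) {κ : ℝ} (hκ : 0 < κ) :
    ∃ δ > 0, ∀ ρ : ContDiffBump (0 : ExtSpace N), ρ.rOut ≤ δ →
      ∀ z ∈ K, |mollify ρ (Ω.indicator v) z - v z| ≤ κ := by
  obtain ⟨r, hr, hrΩ⟩ := hK.exists_cthickening_subset_open hΩ hKΩ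
  have huc := hK.cthickening.uniformContinuousOn_of_continuous (hvc.mono hrΩ)
  obtain ⟨δ, hδ, H⟩ := Metric.uniformContinuousOn_iff.1 huc κ hκ
  refine ⟨min r δ, lt_min hr hδ, fun ρ hρ z hz => ?_⟩
  have hzΩ : z ∈ Ω := hKΩ hz
  have := ρ.dist_normed_convolution_le (μ := volume) (g := Ω.indicator v) (x₀ := z) (ε := κ)
    (hv.integrable_indicator hΩ.measurableSet).aestronglyMeasurable ?_
  · rw [indicator_of_mem hzΩ, Real.dist_eq] at this
    exact this
  · intro x hx
    have hx' : dist x z < ρ.rOut := hx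
    have hxK : x ∈ Metric.cthickening r K :=
      Metric.mem_cthickening_of_dist_le x z r K hz (hx'.le.trans (hρ.trans (min_le_left _ _)))
    rw [indicator_of_mem hzΩ, indicator_of_mem (hrΩ hxK)]
    exact (H x hxK z (Metric.self_subset_cthickening K hz)
      (hx'.trans_le (hρ.trans (min_le_right _ _)))).le

theorem exists_integral_mollify_sub_sq_le {N : ℕ} {f : ExtSpace N → ExtSpace N}
    (hf : MemLp f 2 volume) {ε : ℝ} (hε : 0 < ε) :
    ∃ δ > 0, ∀ ρ : ContDiffBump (0 : ExtSpace N), ρ.rOut ≤ δ →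
      Integrable (fun z => ‖mollify ρ f z - f z‖ ^ 2) ∧
        ∫ z, ‖mollify ρ f z - f z‖ ^ 2 ≤ ε := by
  obtain ⟨δ, hδ, H⟩ := exists_lintegral_convolution_sub_sq_le hf
    (ε := ENNReal.ofReal ε) (by simpa using hε)
  refine ⟨δ, hδ, fun ρ hρ => ?_⟩
  have hc : Continuous (mollify ρ f) :=
    ρ.hasCompactSupport_normed.continuous_convolution_left _ ρ.continuous_normed
      (hf.locallyIntegrable (by norm_num))
  have hm : AEStronglyMeasurable (fun z => ‖mollify ρ f z - f z‖ ^ 2) volume :=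
    (hc.aestronglyMeasurable.sub hf.1).norm.pow 2
  have hl : ∫⁻ z, ENNReal.ofReal (‖mollify ρ f z - f z‖ ^ 2) ≤ ENNReal.ofReal ε := by
    refine le_trans (le_of_eq (lintegral_congr fun z => ?_)) (H ρ hρ)
    rw [ENNReal.ofReal_pow (norm_nonneg _), ofReal_norm]
    rfl
  have hnn : 0 ≤ᵐ[volume] fun z => ‖mollify ρ f z - f z‖ ^ 2 :=
    Eventually.of_forall fun z => by positivity
  refine ⟨⟨hm, ?_⟩, ?_⟩
  · rw [hasFiniteIntegral_iff_ofReal hnn]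
    exact hl.trans_lt ENNReal.ofReal_lt_top
  · rw [integral_eq_lintegral_of_nonneg_ae hnn hm]
    exact ENNReal.toReal_le_of_le_ofReal hε.le hl

theorem continuousOn_snd_rpow {N : ℕ} {K : Set (ExtSpace N)} (h : ∀ z ∈ K, 0 < z.2) (a : ℝ) :
    ContinuousOn (fun z : ExtSpace N => z.2 ^ a) K :=
  continuousOn_snd.rpow_const fun z hz => Or.inl (h z hz).ne'

/-- On a compact subset of `y > 0` the weight has a positive lower bound, so finite weighted energy
controls the unweighted `L²` norm. -/
theorem HasWeightedH1Gradient.memLp_indicator {N : ℕ} {s m : ℝ} {Ω K : Set (ExtSpace N)}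
    {v : ExtSpace N → ℝ} {G : ExtSpace N → ExtSpace N} (h : HasWeightedH1Gradient s m Ω v G)
    (hpos : ∀ z ∈ Ω, 0 < z.2) (hK : IsCompact K) (hKΩ : K ⊆ Ω) :
    MemLp (K.indicator G) 2 volume := by
  rw [memLp_indicator_iff_restrict hK.measurableSet]
  have hG : IntegrableOn G K :=
    h.hasWeakGradient.locallyIntegrableOn_grad.integrableOn_compact_subset hKΩ hK
  rw [memLp_two_iff_integrable_sq_norm hG.aestronglyMeasurable]
  obtain ⟨c, hc, H⟩ := hK.exists_forall_le' (a := 0)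
    (continuousOn_snd_rpow (fun z hz => hpos z (hKΩ hz)) (1 - 2 * s))
    (fun z hz => Real.rpow_pos_of_pos (hpos z (hKΩ hz)) _)
  refine ((h.integrableOn_energy.mono_set hKΩ).const_mul c⁻¹).mono'
    (hG.aestronglyMeasurable.norm.pow 2) ?_
  filter_upwards [ae_restrict_mem hK.measurableSet] with z hz
  rw [Real.norm_of_nonneg (by positivity), ← div_eq_inv_mul, le_div_iff₀ hc]
  have h1 := ExtSpace.norm_sq_le (G z)
  have h2 : 0 ≤ m ^ 2 * v z ^ 2 := by positivity
  calc ‖G z‖ ^ 2 * c ≤ ‖G z‖ ^ 2 * z.2 ^ (1 - 2 * s) := by gcongr; exact H z hz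
    _ = z.2 ^ (1 - 2 * s) * ‖G z‖ ^ 2 := mul_comm _ _
    _ ≤ _ := by
      have := hc.le.trans (H z hz)
      gcongr
      linarith

/-- Pairing an integrable vector field with a continuous field of linear forms. -/
theorem MeasureTheory.IntegrableOn.mul_clm_apply {N : ℕ} {K : Set (ExtSpace N)} (hK : IsCompact K)
    {ω : ExtSpace N → ℝ} (hω : ContinuousOn ω K) {A : ExtSpace N → ExtSpace N →L[ℝ] ℝ}
    (hA : Continuous A) {H : ExtSpace N → ExtSpace N} (hH : IntegrableOn H K) :
    IntegrableOn (fun z => ω z * A z (H z)) K := by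
  have hmeas : AEStronglyMeasurable (fun z => A z (H z)) (volume.restrict K) :=
    (ContinuousLinearMap.apply ℝ ℝ).flip.aestronglyMeasurable_comp₂
      hA.aestronglyMeasurable hH.aestronglyMeasurable
  obtain ⟨C, hC⟩ := hK.exists_bound_of_continuousOn hA.continuousOn
  have : IntegrableOn (fun z => A z (H z)) K := by
    refine (hH.norm.const_mul C).mono' hmeas ?_
    filter_upwards [ae_restrict_mem hK.measurableSet] with z hz
    exact ((A z).le_opNorm _).trans (by gcongr; exact hC z hz)
  exact this.continuousOn_mul hω hK

/-- The truncated test function `((u - k)⁺)²` restricted to `K` is of class `C¹` as soon as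
`u ≤ k` on a neighbourhood of `K`, outside `K`. -/
theorem isTestFunction_indicator_max_sq {N : ℕ} {D O K : Set (ExtSpace N)} {u : ExtSpace N → ℝ}
    {k : ℝ} (hO : IsOpen O) (hK : IsCompact K) (hKO : K ⊆ O) (hKD : K ⊆ D)
    (hu : ContDiffOn ℝ 1 u O) (hle : ∀ z ∈ O \ K, u z ≤ k) :
    IsTestFunction 1 D (K.indicator fun z => (max (u z - k) 0) ^ 2) ∧
      ∀ z ∈ K, ∀ e, fderiv ℝ (K.indicator fun z => (max (u z - k) 0) ^ 2) z e =
        2 * max (u z - k) 0 * fderiv ℝ u z e := by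
  set φ : ExtSpace N → ℝ := K.indicator fun z => (max (u z - k) 0) ^ 2 with hφ
  -- On `O` the cut-off by `K` is invisible: the truncation already vanishes on `O \ K`.
  have heq : ∀ z ∈ O, φ z = (max (u z - k) 0) ^ 2 := by
    intro z hz
    by_cases hzK : z ∈ K
    · rw [hφ, indicator_of_mem hzK]
    · rw [hφ, indicator_of_notMem hzK, max_eq_right (by linarith [hle z ⟨hz, hzK⟩])]
      simp
  have hev : ∀ z ∈ O, φ =ᶠ[𝓝 z] fun z => (max (u z - k) 0) ^ 2 := fun z hz =>
    (hO.eventually_mem hz).mono heq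
  have hsupp : tsupport φ ⊆ K := closure_minimal support_indicator_subset hK.isClosed
  refine ⟨⟨?_, HasCompactSupport.of_support_subset_isCompact hK support_indicator_subset,
    hsupp.trans hKD⟩, ?_⟩
  · rw [contDiff_iff_contDiffAt]
    intro z
    by_cases hz : z ∈ O
    · refine ContDiffAt.congr_of_eventuallyEq ?_ (hev z hz)
      have h1 : ContDiffAt ℝ 1 (fun z => u z - k) z :=
        ((hu z hz).contDiffAt (hO.mem_nhds hz)).sub contDiffAt_const
      exact contDiff_max_zero_sq.contDiffAt.comp z h1
    · have hzK : z ∉ tsupport φ := fun h => hz (hKO (hsupp h))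
      exact contDiffAt_const.congr_of_eventuallyEq (notMem_tsupport_iff_eventuallyEq.1 hzK)
  · intro z hz e
    have hud : HasFDerivAt u (fderiv ℝ u z) z :=
      (((hu z (hKO hz)).contDiffAt (hO.mem_nhds (hKO hz))).differentiableAt
        one_ne_zero).hasFDerivAt
    have h1 := (hasDerivAt_max_zero_sq (u z - k)).comp_hasFDerivAt z (hud.sub_const k)
    have h2 := h1.congr_of_eventuallyEq (hev z (hKO hz))
    rw [h2.fderiv]
    simp

/-! ### Comparison principle -/

/-- Comparison principle: a weak supersolution which lies above a `C¹` weak subsolution near the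
boundary of `D` lies above it in `D`. -/
theorem IsWeakSupersolution.le_of_subsolution {N : ℕ} {s m : ℝ} (hm : 0 < m)
    {Ω D K : Set (ExtSpace N)} (hΩ : IsOpen Ω) (hpos : ∀ z ∈ Ω, 0 < z.2) {v : ExtSpace N → ℝ}
    (hvi : IntegrableOn v Ω) (hvc : ContinuousOn v Ω) (hv : IsWeakSupersolution s m Ω v)
    (hD : IsOpen D) (hDΩ : D ⊆ Ω) (hK : IsCompact K) (hKD : K ⊆ D) {W : ExtSpace N → ℝ}
    {gW : ExtSpace N → ExtSpace N} (hW : ContDiffOn ℝ 1 W D) (hgW : ContinuousOn gW D)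
    (hWd : ∀ z ∈ D, ∀ e, fderiv ℝ W z e = ExtSpace.dot (gW z) e)
    (hWs : ∀ φ : ExtSpace N → ℝ, IsTestFunction 1 D φ → (∀ z, 0 ≤ φ z) →
      ∫ z in Ω, z.2 ^ (1 - 2 * s) * (fderiv ℝ φ z (gW z) + m ^ 2 * W z * φ z) ≤ 0)
    (hKW : ∀ z ∈ D \ K, W z ≤ v z) : ∀ z ∈ D, W z ≤ v z := by
  by_contra! hcon
  obtain ⟨z₀, hz₀, hlt⟩ := hcon
  obtain ⟨G, hG, hGs⟩ := hv
  set M := W z₀ - v z₀ with hM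
  have hMpos : 0 < M := sub_pos.2 hlt
  have hKΩ : K ⊆ Ω := hKD.trans hDΩ
  have hucont : ContinuousOn (fun z => W z - v z) D := hW.continuousOn.sub (hvc.mono hDΩ)
  have hωc : ContinuousOn (fun z : ExtSpace N => z.2 ^ (1 - 2 * s)) K :=
    continuousOn_snd_rpow (fun z hz => hpos z (hKΩ hz)) _
  -- `K₁ ⊆ D` leaves room around `K` for the test function to be `C¹`; `K₂ ⊆ Ω` contains the balls
  -- over which the mollification averages.
  obtain ⟨r, hr, hrD⟩ := hK.exists_cthickening_subset_open hD hKD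
  set K₁ := Metric.cthickening r K with hK₁
  have hK₁c : IsCompact K₁ := hK.cthickening
  obtain ⟨r', hr', hrΩ⟩ := hK₁c.exists_cthickening_subset_open hΩ (hrD.trans hDΩ)
  set K₂ := Metric.cthickening r' K₁ with hK₂
  have hK₂c : IsCompact K₂ := hK₁c.cthickening
  have hKK₁ : K ⊆ K₁ := Metric.self_subset_cthickening K
  have hKK₂ : K ⊆ K₂ := hKK₁.trans (Metric.self_subset_cthickening K₁)
  obtain ⟨c, hc, hcK⟩ := hK.exists_forall_le' (a := 0) hωc
    (fun z hz => Real.rpow_pos_of_pos (hpos z (hKΩ hz)) _)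
  obtain ⟨Y, hY⟩ := hK.exists_bound_of_continuousOn hωc
  obtain ⟨B, hB⟩ := hK.exists_bound_of_continuousOn (hucont.mono hKD)
  have hBK : ∀ z ∈ K, W z - v z ≤ B := fun z hz => (le_abs_self _).trans (hB z hz)
  have hYK : ∀ z ∈ K, z.2 ^ (1 - 2 * s) ≤ Y := fun z hz => (le_abs_self _).trans (hY z hz)
  set U := D ∩ (fun z => W z - v z) ⁻¹' Ioi (3 * M / 4) with hU
  have hUo : IsOpen U := hucont.isOpen_inter_preimage hD isOpen_Ioi
  have hUK : U ⊆ K := by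
    intro z hz
    by_contra hzK
    have h1 := hKW z ⟨hz.1, hzK⟩
    have h2 : 3 * M / 4 < W z - v z := hz.2
    linarith
  have hz₀U : z₀ ∈ U := ⟨hz₀, show 3 * M / 4 < W z₀ - v z₀ by linarith⟩
  have hz₀K : z₀ ∈ K := hUK hz₀U
  have hUfin : volume U ≠ ∞ := ((measure_mono hUK).trans_lt hK.measure_lt_top).ne
  have hUpos : 0 < volume.real U :=
    ENNReal.toReal_pos (hUo.measure_pos volume ⟨z₀, hz₀U⟩).ne' hUfin
  -- Lower bound of the mass term on `U`: there `W - v > 3M/4`, and the truncation is at least `3M/4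
  -- - M/8 - M/4 = 3M/8`, where `M/8` is the mollification error and `M/4` the truncation level.
  set b := c * (m ^ 2 * (3 * M / 4) * (3 * M / 8) ^ 2) with hb
  have hbpos : 0 < b := by positivity
  have hB0 : 0 < B := hMpos.trans_le (hBK z₀ hz₀K)
  have hY0 : 0 < Y := hc.trans_le ((hcK z₀ hz₀K).trans (hYK z₀ hz₀K))
  set C := Y * (B + M) with hC
  have hCpos : 0 < C := by positivity
  obtain ⟨δ₁, hδ₁, H₁⟩ := exists_abs_mollify_sub_le hΩ hvi hvc hK₁c (hrD.trans hDΩ)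
    (show 0 < M / 8 by positivity)
  -- After multiplication by `C`, this tolerance costs at most half of the gain `b * volume.real U`.
  obtain ⟨δ₂, hδ₂, H₂⟩ := exists_integral_mollify_sub_sq_le
    (hG.memLp_indicator hpos hK₂c hrΩ) (show 0 < b * volume.real U / (2 * C) by positivity)
  have hδ : 0 < min r' (min δ₁ δ₂) := lt_min hr' (lt_min hδ₁ hδ₂)
  let ρ : ContDiffBump (0 : ExtSpace N) :=
    ⟨min r' (min δ₁ δ₂) / 2, min r' (min δ₁ δ₂), half_pos hδ, half_lt_self hδ⟩
  have hρr : ρ.rOut ≤ r' := min_le_left _ _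
  set w := mollify ρ (Ω.indicator v) with hw
  set g := mollify ρ (K₂.indicator G) with hg
  have hwv : ∀ z ∈ K₁, |w z - v z| ≤ M / 8 :=
    H₁ ρ ((min_le_right _ _).trans (min_le_left _ _))
  obtain ⟨hgi, hgle⟩ := H₂ ρ ((min_le_right _ _).trans (min_le_right _ _))
  have hwd : ∀ z ∈ K, ∀ e, fderiv ℝ w z e = ExtSpace.dot (g z) e := by
    intro z hz e
    refine hG.hasWeakGradient.fderiv_mollify hΩ.measurableSet hvi hK₂c hrΩ ?_ e
    intro x hx
    exact Metric.mem_cthickening_of_dist_le x z r' K₁ (hKK₁ hz)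
      ((Metric.mem_closedBall.1 hx).trans hρr)
  have hwc : ContDiff ℝ 1 w :=
    contDiff_mollify (hvi.integrable_indicator hΩ.measurableSet).locallyIntegrable
  set O := Metric.thickening r K with hO
  have hOK₁ : O ⊆ K₁ := Metric.thickening_subset_cthickening r K
  have huO : ContDiffOn ℝ 1 (fun z => W z - w z) O :=
    (hW.mono (hOK₁.trans hrD)).sub hwc.contDiffOn
  -- Outside `K`, `W - w ≤ v - w ≤ M/8`, safely below the level `M/4`.
  obtain ⟨hφ, hφd⟩ := isTestFunction_indicator_max_sq (D := D) (k := M / 4)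
    Metric.isOpen_thickening hK (Metric.self_subset_thickening hr K) hKD huO (by
      intro z hz
      have h1 := hKW z ⟨hrD (hOK₁ hz.1), hz.2⟩
      have h2 := abs_le.1 (hwv z (hOK₁ hz.1))
      linarith)
  set φ : ExtSpace N → ℝ := K.indicator fun z => (max (W z - w z - M / 4) 0) ^ 2 with hφdef
  have hφ0 : ∀ z, 0 ≤ φ z := fun z => indicator_nonneg (fun _ _ => sq_nonneg _) z
  have hφK : ∀ z ∈ K, φ z = (max (W z - w z - M / 4) 0) ^ 2 := fun z hz => by
    rw [hφdef, indicator_of_mem hz]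
  have hφout : ∀ z ∈ Ω \ K, φ z = 0 := fun z hz => by
    rw [hφdef, indicator_of_notMem hz.2]
  have hφdout : ∀ z ∈ Ω \ K, fderiv ℝ φ z = 0 := fun z hz => by
    refine image_eq_zero_of_notMem_tsupport fun h => hz.2 ?_
    exact closure_minimal support_indicator_subset hK.isClosed (tsupport_fderiv_subset ℝ h)
  have hφd' : ∀ z ∈ K, ∀ e, fderiv ℝ φ z e =
      2 * max (W z - w z - M / 4) 0 * ExtSpace.dot (gW z - g z) e := by
    intro z hz e
    have hWz : DifferentiableAt ℝ W z :=
      ((hW z (hKD hz)).contDiffAt (hD.mem_nhds (hKD hz))).differentiableAt one_ne_zero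
    rw [hφd z hz e, show (fun z => W z - w z) = W - w from rfl,
      fderiv_sub hWz (hwc.differentiable one_ne_zero z), ExtSpace.dot_sub_left,
      ← hWd z (hKD hz) e, ← hwd z hz e]
    simp
  have hfc : Continuous (fderiv ℝ φ) := hφ.contDiff.continuous_fderiv one_ne_zero
  have hGK : IntegrableOn G K :=
    hG.hasWeakGradient.locallyIntegrableOn_grad.integrableOn_compact_subset hKΩ hK
  have hgWK : IntegrableOn gW K := (hgW.mono hKD).integrableOn_compact hK
  have hφc : ContinuousOn φ K := hφ.contDiff.continuous.continuousOn
  have hI : ∀ (f : ExtSpace N → ℝ) (H : ExtSpace N → ExtSpace N), ContinuousOn f K →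
      IntegrableOn H K → IntegrableOn
        (fun z => z.2 ^ (1 - 2 * s) * (fderiv ℝ φ z (H z) + m ^ 2 * f z * φ z)) K := by
    intro f H hf hH
    simp_rw [mul_add]
    refine (IntegrableOn.mul_clm_apply hK hωc hfc hH).add (ContinuousOn.integrableOn_compact hK ?_)
    exact hωc.mul ((continuousOn_const.mul hf).mul hφc)
  have hred : ∀ (f : ExtSpace N → ℝ) (H : ExtSpace N → ExtSpace N),
      ∫ z in Ω, z.2 ^ (1 - 2 * s) * (fderiv ℝ φ z (H z) + m ^ 2 * f z * φ z) =
      ∫ z in K, z.2 ^ (1 - 2 * s) * (fderiv ℝ φ z (H z) + m ^ 2 * f z * φ z) := by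
    intro f H
    refine setIntegral_eq_of_subset_of_forall_sdiff_eq_zero hΩ.measurableSet hKΩ fun z hz => ?_
    rw [hφout z hz, hφdout z hz]
    simp
  have hI₁ := hI v G (hvc.mono hKΩ) hGK
  have hI₂ := hI W gW (hW.continuousOn.mono hKD) hgWK
  have hsup := hGs φ ⟨hφ.contDiff, hφ.hasCompactSupport, hφ.tsupport_subset.trans hDΩ⟩ hφ0
  have hsub := hWs φ hφ hφ0
  rw [hred] at hsup hsub
  -- The right side has nonpositive integral, by subtracting the supersolution inequality from the
  -- subsolution one. Its gradient part contains `(gW - g) · (gW - G)`, a square up to `‖g - G‖²`.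
  -- The left side has positive integral by the choice of `b` and `δ₂`.
  have hpt : ∀ z ∈ K, U.indicator (fun _ => b) z - C * ‖g z - K₂.indicator G z‖ ^ 2 ≤
      z.2 ^ (1 - 2 * s) * (fderiv ℝ φ z (gW z) + m ^ 2 * W z * φ z) -
      z.2 ^ (1 - 2 * s) * (fderiv ℝ φ z (G z) + m ^ 2 * v z * φ z) := by
    intro z hz
    have hωz : 0 < z.2 ^ (1 - 2 * s) := hc.trans_le (hcK z hz)
    rw [indicator_of_mem (hKK₂ hz)]
    have e : z.2 ^ (1 - 2 * s) * (fderiv ℝ φ z (gW z) + m ^ 2 * W z * φ z) -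
        z.2 ^ (1 - 2 * s) * (fderiv ℝ φ z (G z) + m ^ 2 * v z * φ z) =
        z.2 ^ (1 - 2 * s) * (2 * max (W z - w z - M / 4) 0 *
          ExtSpace.dot (gW z - g z) (gW z - G z)) +
        z.2 ^ (1 - 2 * s) * (m ^ 2 * (W z - v z) * φ z) := by
      rw [← hφd' z hz, map_sub]; ring
    rw [e]
    have hw1 := abs_le.1 (hwv z (hKK₁ hz))
    set q := max (W z - w z - M / 4) 0 with hq
    have hq0 : 0 ≤ q := le_max_right _ _
    have hqB : q ≤ B + M := max_le (by linarith [hBK z hz]) (by linarith)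
    have h1 : -(C * ‖g z - G z‖ ^ 2) ≤
        z.2 ^ (1 - 2 * s) * (2 * q * ExtSpace.dot (gW z - g z) (gW z - G z)) := by
      have h2 := ExtSpace.neg_le_dot (gW z - g z) (gW z - G z)
      rw [show gW z - G z - (gW z - g z) = g z - G z by abel] at h2
      have h3 : z.2 ^ (1 - 2 * s) * q ≤ C := by
        rw [hC]; gcongr; exact hYK z hz
      have h4 := mul_le_mul_of_nonneg_left h2 (mul_nonneg hωz.le hq0)
      have h5 := mul_le_mul_of_nonneg_right h3 (sq_nonneg ‖g z - G z‖)
      linarith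
    have h2 : U.indicator (fun _ => b) z ≤
        z.2 ^ (1 - 2 * s) * (m ^ 2 * (W z - v z) * φ z) := by
      rw [hφK z hz]
      by_cases hzU : z ∈ U
      · rw [indicator_of_mem hzU, hb]
        have h3 : 3 * M / 4 < W z - v z := hzU.2
        have h4 : 3 * M / 8 ≤ q := le_trans (by linarith) (le_max_left _ _)
        have h5 : 0 ≤ m ^ 2 * (W z - v z) := mul_nonneg (sq_nonneg m) (by linarith)
        gcongr
        exact hcK z hz
      · rw [indicator_of_notMem hzU]
        rcases le_or_gt (W z - w z - M / 4) 0 with h | h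
        · rw [max_eq_right h]; simp
        · have : 0 ≤ W z - v z := by linarith
          positivity
    linarith
  have hUi : IntegrableOn (U.indicator fun _ => b) K :=
    ((integrable_indicator_iff hUo.measurableSet).2
      (integrableOn_const hUfin)).integrableOn
  have hgK : IntegrableOn (fun z => C * ‖g z - K₂.indicator G z‖ ^ 2) K :=
    (hgi.const_mul C).integrableOn
  have hmain := setIntegral_mono_on (hUi.sub hgK) (hI₂.sub hI₁) hK.measurableSet hpt
  simp only [Pi.sub_apply] at hmain
  rw [integral_sub hUi hgK, integral_sub hI₂ hI₁, setIntegral_indicator hUo.measurableSet,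
    inter_eq_right.2 hUK, setIntegral_const, integral_const_mul, smul_eq_mul] at hmain
  have hle : ∫ z in K, ‖g z - K₂.indicator G z‖ ^ 2 ≤ b * volume.real U / (2 * C) :=
    (setIntegral_le_integral hgi (Eventually.of_forall fun z => by positivity)).trans hgle
  have hle' : C * ∫ z in K, ‖g z - K₂.indicator G z‖ ^ 2 ≤ b * volume.real U / 2 := by
    calc _ ≤ C * (b * volume.real U / (2 * C)) := by gcongr
      _ = _ := by field_simp
  have : 0 < b * volume.real U := by positivity
  linarith [mul_comm b (volume.real U)]

/-! ### The barrier -/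

/-- The barrier `y^{2s} (1 - B |x|²) + A y^{2s+1}`. -/
noncomputable def hopfBarrier {N : ℕ} (s A B : ℝ) (z : ExtSpace N) : ℝ :=
  z.2 ^ (2 * s) * (1 - B * ‖z.1‖ ^ 2) + A * z.2 ^ (2 * s + 1)

/-- The flux `y^{1-2s} ∇w` of the barrier `w`. -/
noncomputable def hopfFlux {N : ℕ} (s A B : ℝ) (z : ExtSpace N) : ExtSpace N :=
  (-(2 * B * z.2) • z.1, 2 * s * (1 - B * ‖z.1‖ ^ 2) + (2 * s + 1) * A * z.2)

/-- The weight cancels every fractional power, so the flux is polynomial and continuous across `y =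
0`. -/
theorem continuous_hopfFlux {N : ℕ} (s A B : ℝ) : Continuous (hopfFlux (N := N) s A B) := by
  unfold hopfFlux
  fun_prop

theorem continuous_hopfBarrier {N : ℕ} {s : ℝ} (hs : 0 < s) (A B : ℝ) :
    Continuous (hopfBarrier (N := N) s A B) := by
  unfold hopfBarrier
  have h1 : Continuous fun z : ExtSpace N => z.2 ^ (2 * s) :=
    continuous_snd.rpow_const fun _ => Or.inr (by positivity)
  have h2 : Continuous fun z : ExtSpace N => z.2 ^ (2 * s + 1) :=
    continuous_snd.rpow_const fun _ => Or.inr (by positivity)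
  fun_prop

theorem hasFDerivAt_hopfBarrier {N : ℕ} (s A B : ℝ) {z : ExtSpace N} (hz : 0 < z.2) :
    HasFDerivAt (hopfBarrier s A B) (ExtSpace.dotCLM (z.2 ^ (2 * s - 1) • hopfFlux s A B z)) z := by
  have h1 : ∀ p : ℝ, HasFDerivAt (fun z : ExtSpace N => z.2 ^ p)
      ((p * z.2 ^ (p - 1)) • ContinuousLinearMap.snd ℝ _ _) z := fun p =>
    (Real.hasDerivAt_rpow_const (Or.inl hz.ne')).comp_hasFDerivAt z hasFDerivAt_snd
  have h2 : HasFDerivAt (fun z : ExtSpace N => ‖z.1‖ ^ 2)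
      ((2 • innerSL ℝ z.1).comp (ContinuousLinearMap.fst ℝ _ _)) z :=
    (hasStrictFDerivAt_norm_sq z.1).hasFDerivAt.comp z hasFDerivAt_fst
  have h3 := ((h1 (2 * s)).mul ((h2.const_mul B).const_sub 1)).add ((h1 (2 * s + 1)).const_mul A)
  refine h3.congr_fderiv ?_
  ext e
  · simp [ExtSpace.dotCLM_apply, ExtSpace.dot, hopfFlux, inner_smul_right, real_inner_comm]
    rw [show z.2 ^ (2 * s) = z.2 ^ (2 * s - 1) * z.2 by
      rw [← Real.rpow_add_one hz.ne']; ring_nf]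
    ring
  · simp [ExtSpace.dotCLM_apply, ExtSpace.dot, hopfFlux]
    rw [show z.2 ^ (2 * s) = z.2 ^ (2 * s - 1) * z.2 by
      rw [← Real.rpow_add_one hz.ne']; ring_nf]
    ring

/-- Integration by parts against a compactly supported `C¹` function. -/
theorem integral_mul_fderiv_eq_neg {N : ℕ} {h φ : ExtSpace N → ℝ} (hh : ContDiff ℝ 1 h)
    (hφ : ContDiff ℝ 1 φ) (hc : HasCompactSupport φ) (e : ExtSpace N) :
    ∫ z, h z * fderiv ℝ φ z e = - ∫ z, fderiv ℝ h z e * φ z := by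
  have hφ' : Continuous fun z => fderiv ℝ φ z e :=
    (hφ.continuous_fderiv one_ne_zero).clm_apply continuous_const
  have hh' : Continuous fun z => fderiv ℝ h z e :=
    (hh.continuous_fderiv one_ne_zero).clm_apply continuous_const
  refine integral_mul_fderiv_eq_neg_fderiv_mul_of_integrable ?_ ?_ ?_
    (fun z _ => hh.differentiable one_ne_zero z) (fun z _ => hφ.differentiable one_ne_zero z)
  · exact (hh'.mul hφ.continuous).integrable_of_hasCompactSupport hc.mul_left
  · exact (hh.continuous.mul hφ').integrable_of_hasCompactSupport
      (hc.fderiv_apply ℝ e).mul_left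
  · exact (hh.continuous.mul hφ.continuous).integrable_of_hasCompactSupport hc.mul_left

theorem hopfFlux_eq_sum {N : ℕ} (s A B : ℝ) (z : ExtSpace N) :
    hopfFlux s A B z = (∑ i, (-(2 * B) * (z.2 * z.1 i)) •
        ((EuclideanSpace.single i (1 : ℝ), 0) : ExtSpace N)) +
      (2 * s * (1 - B * ‖z.1‖ ^ 2) + (2 * s + 1) * A * z.2) • ((0, 1) : ExtSpace N) := by
  refine Prod.ext ?_ ?_
  · ext j
    simp [hopfFlux, Prod.fst_sum, Pi.single_apply]
    ring
  · simp [hopfFlux, Prod.snd_sum]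

/-- The flux is smooth on the whole space, with divergence `-2BNy + (2s+1)A`; the part coming from
`y^{2s}` alone does not depend on `y` and contributes nothing to its `y`-derivative. -/
theorem integral_fderiv_hopfFlux {N : ℕ} (s A B : ℝ) {φ : ExtSpace N → ℝ}
    (hφ : ContDiff ℝ 1 φ) (hc : HasCompactSupport φ) :
    ∫ z, fderiv ℝ φ z (hopfFlux s A B z) =
      ∫ z, (2 * B * N * z.2 - (2 * s + 1) * A) * φ z := by
  have hφ' : ∀ e, Continuous fun z => fderiv ℝ φ z e := fun e =>
    (hφ.continuous_fderiv one_ne_zero).clm_apply continuous_const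
  have hint : ∀ (h : ExtSpace N → ℝ) (e : ExtSpace N), Continuous h →
      Integrable fun z => h z * fderiv ℝ φ z e := fun h e hh =>
    (hh.mul (hφ' e)).integrable_of_hasCompactSupport (hc.fderiv_apply ℝ e).mul_left
  have hint' : ∀ (h : ExtSpace N → ℝ), Continuous h → Integrable fun z => h z * φ z := fun h hh =>
    (hh.mul hφ.continuous).integrable_of_hasCompactSupport hc.mul_left
  have hx : ∀ i, ContDiff ℝ 1 fun z : ExtSpace N => -(2 * B) * (z.2 * z.1 i) := by
    intro i
    fun_prop
  have hy : ContDiff ℝ 1 fun z : ExtSpace N =>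
      2 * s * (1 - B * ‖z.1‖ ^ 2) + (2 * s + 1) * A * z.2 := by
    have : ContDiff ℝ 1 fun z : ExtSpace N => ‖z.1‖ ^ 2 := contDiff_fst.norm_sq ℝ
    fun_prop
  have hxd : ∀ i (z : ExtSpace N), fderiv ℝ (fun z : ExtSpace N => -(2 * B) * (z.2 * z.1 i)) z
      (EuclideanSpace.single i 1, 0) = -(2 * B) * z.2 := by
    intro i z
    have h1 : HasFDerivAt (fun z : ExtSpace N => z.1 i)
        ((EuclideanSpace.proj i).comp (ContinuousLinearMap.fst ℝ _ _)) z :=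
      ((EuclideanSpace.proj i).comp (ContinuousLinearMap.fst ℝ (EuclideanSpace ℝ (Fin N)) ℝ) :
        ExtSpace N →L[ℝ] ℝ).hasFDerivAt
    have h2 := ((hasFDerivAt_snd (𝕜 := ℝ) (p := z)).mul h1).const_mul (-(2 * B))
    rw [show fderiv ℝ (fun z : ExtSpace N => -(2 * B) * (z.2 * z.1 i)) z = _ from h2.fderiv]
    simp
  have hyd : ∀ z : ExtSpace N, fderiv ℝ (fun z : ExtSpace N =>
      2 * s * (1 - B * ‖z.1‖ ^ 2) + (2 * s + 1) * A * z.2) z (0, 1) = (2 * s + 1) * A := by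
    intro z
    have h1 : HasFDerivAt (fun z : ExtSpace N => ‖z.1‖ ^ 2)
        ((2 • innerSL ℝ z.1).comp (ContinuousLinearMap.fst ℝ _ _)) z :=
      (hasStrictFDerivAt_norm_sq z.1).hasFDerivAt.comp z hasFDerivAt_fst
    have h2 := (((h1.const_mul B).const_sub 1).const_mul (2 * s)).add
      ((hasFDerivAt_snd (𝕜 := ℝ) (p := z)).const_mul ((2 * s + 1) * A))
    rw [show fderiv ℝ (fun z : ExtSpace N =>
      2 * s * (1 - B * ‖z.1‖ ^ 2) + (2 * s + 1) * A * z.2) z = _ from h2.fderiv]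
    simp
  have e1 : ∀ z, fderiv ℝ φ z (hopfFlux s A B z) =
      (∑ i, (-(2 * B) * (z.2 * z.1 i)) * fderiv ℝ φ z (EuclideanSpace.single i 1, 0)) +
      (2 * s * (1 - B * ‖z.1‖ ^ 2) + (2 * s + 1) * A * z.2) * fderiv ℝ φ z (0, 1) := by
    intro z
    rw [hopfFlux_eq_sum, map_add, map_sum]
    simp only [map_smul, smul_eq_mul]
  simp_rw [e1]
  rw [integral_add (integrable_finsetSum _ fun i _ => hint _ _ (hx i).continuous)
    (hint _ _ hy.continuous), integral_finsetSum _ fun i _ => hint _ _ (hx i).continuous]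
  rw [integral_mul_fderiv_eq_neg hy hφ hc]
  simp_rw [fun i => integral_mul_fderiv_eq_neg (hx i) hφ hc (EuclideanSpace.single i 1, 0), hxd,
    hyd]
  rw [Finset.sum_const, Finset.card_univ, Fintype.card_fin, nsmul_eq_mul, ← integral_neg,
    ← integral_const_mul, ← integral_neg, ← integral_add]
  · refine integral_congr_ae (Eventually.of_forall fun z => ?_)
    simp only
    ring
  · exact ((hint' _ (by fun_prop)).neg).const_mul _
  · exact (hint' _ (by fun_prop)).neg

/-- The barrier, scaled and shifted down by a constant, is a weak subsolution in a thin domain. -/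
theorem hopfBarrier_subsolution {N : ℕ} {s m A B ε η y₀ : ℝ} (hB : 0 ≤ B)
    (hε : 0 ≤ ε) (hη : 0 ≤ η) {Ω D : Set (ExtSpace N)} (hΩ : MeasurableSet Ω) (hDΩ : D ⊆ Ω)
    (hD : ∀ z ∈ D, z.2 ∈ Ioo 0 y₀)
    (hsub : ∀ y ∈ Ioo 0 y₀, 2 * B * N * y - (2 * s + 1) * A + m ^ 2 * (y + A * y ^ 2) ≤ 0)
    {φ : ExtSpace N → ℝ} (hφ : IsTestFunction 1 D φ) (hφ0 : ∀ z, 0 ≤ φ z) :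
    ∫ z in Ω, z.2 ^ (1 - 2 * s) *
      (fderiv ℝ φ z (ε • z.2 ^ (2 * s - 1) • hopfFlux s A B z) +
        m ^ 2 * (ε * hopfBarrier s A B z - η) * φ z) ≤ 0 := by
  have hc := hφ.hasCompactSupport
  have hT : IsCompact (tsupport φ) := hc
  have hTpos : ∀ z ∈ tsupport φ, 0 < z.2 := fun z hz => (hD z (hφ.tsupport_subset hz)).1
  have hφz : ∀ z, z ∉ tsupport φ → φ z = 0 := fun z => image_eq_zero_of_notMem_tsupport
  have hφ'z : ∀ z, z ∉ tsupport φ → fderiv ℝ φ z = 0 := fun z hz =>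
    image_eq_zero_of_notMem_tsupport fun h => hz (tsupport_fderiv_subset ℝ h)
  have hfc : Continuous (fderiv ℝ φ) := hφ.contDiff.continuous_fderiv one_ne_zero
  have hflux := continuous_hopfFlux (N := N) s A B
  have hF : Continuous fun z => fderiv ℝ φ z (hopfFlux s A B z) := hfc.clm_apply hflux
  have hp : ∀ p : ℝ, ContinuousOn (fun z : ExtSpace N => z.2 ^ p) (tsupport φ) :=
    continuousOn_snd_rpow hTpos
  have hFi : Integrable fun z => fderiv ℝ φ z (hopfFlux s A B z) :=
    hF.integrable_of_hasCompactSupport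
      (HasCompactSupport.intro hT fun z hz => by rw [hφ'z z hz]; rfl)
  have hRi : ∀ h : ℝ → ℝ, Continuous h → Integrable fun z : ExtSpace N => h z.2 * φ z :=
    fun h hh => ((hh.comp continuous_snd).mul
      hφ.contDiff.continuous).integrable_of_hasCompactSupport hc.mul_left
  have hR1 := hRi (fun y => m ^ 2 * (y + A * y ^ 2)) (by fun_prop)
  rw [setIntegral_eq_of_subset_of_forall_sdiff_eq_zero hΩ (hφ.tsupport_subset.trans hDΩ)
    (fun z hz => by rw [hφz z hz.2, hφ'z z hz.2]; simp)]
  have hL : ContinuousOn (fun z : ExtSpace N => z.2 ^ (1 - 2 * s) *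
      (fderiv ℝ φ z (ε • z.2 ^ (2 * s - 1) • hopfFlux s A B z) +
        m ^ 2 * (ε * hopfBarrier s A B z - η) * φ z)) (tsupport φ) := by
    have h1 : ContinuousOn (hopfBarrier (N := N) s A B) (tsupport φ) := fun z hz =>
      (hasFDerivAt_hopfBarrier s A B (hTpos z hz)).continuousAt.continuousWithinAt
    have h2 : ContinuousOn (fun z : ExtSpace N => ε • z.2 ^ (2 * s - 1) • hopfFlux s A B z)
      (tsupport φ) := ((hp _).smul hflux.continuousOn).const_smul ε
    exact (hp _).mul ((hfc.continuousOn.clm_apply h2).add ((continuousOn_const.mul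
      ((continuousOn_const.mul h1).sub continuousOn_const)).mul
        hφ.contDiff.continuous.continuousOn))
  -- In the mass term the contributions of `-B|x|²` and `-η` are nonpositive and are dropped.
  have hpt : ∀ z ∈ tsupport φ, z.2 ^ (1 - 2 * s) *
      (fderiv ℝ φ z (ε • z.2 ^ (2 * s - 1) • hopfFlux s A B z) +
        m ^ 2 * (ε * hopfBarrier s A B z - η) * φ z) ≤
      ε * (fderiv ℝ φ z (hopfFlux s A B z) + m ^ 2 * (z.2 + A * z.2 ^ 2) * φ z) := by
    intro z hz
    have hy := hTpos z hz
    have e1 : z.2 ^ (1 - 2 * s) * z.2 ^ (2 * s - 1) = 1 := by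
      rw [← Real.rpow_add hy]; simp
    have e2 : z.2 ^ (1 - 2 * s) * z.2 ^ (2 * s) = z.2 := by
      rw [← Real.rpow_add hy]; simp
    have e3 : z.2 ^ (1 - 2 * s) * z.2 ^ (2 * s + 1) = z.2 ^ 2 := by
      rw [← Real.rpow_add hy, ← Real.rpow_natCast]
      congr 1
      push_cast
      ring
    have h1 : z.2 ^ (1 - 2 * s) * hopfBarrier s A B z ≤ z.2 + A * z.2 ^ 2 := by
      have : z.2 ^ (1 - 2 * s) * hopfBarrier s A B z =
          z.2 * (1 - B * ‖z.1‖ ^ 2) + A * z.2 ^ 2 := by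
        rw [hopfBarrier, mul_add, ← mul_assoc, e2, mul_left_comm, e3]
      rw [this]
      have : 0 ≤ z.2 * (B * ‖z.1‖ ^ 2) := by positivity
      linarith
    have h2 : z.2 ^ (1 - 2 * s) * (ε * hopfBarrier s A B z - η) ≤ ε * (z.2 + A * z.2 ^ 2) := by
      have : 0 ≤ z.2 ^ (1 - 2 * s) * η := by positivity
      have := mul_le_mul_of_nonneg_left h1 hε
      linarith
    rw [map_smul, map_smul, smul_eq_mul, smul_eq_mul]
    have h3 := mul_le_mul_of_nonneg_left h2 (mul_nonneg (sq_nonneg m) (hφ0 z))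
    calc _ = ε * ((z.2 ^ (1 - 2 * s) * z.2 ^ (2 * s - 1)) * fderiv ℝ φ z (hopfFlux s A B z)) +
          m ^ 2 * φ z * (z.2 ^ (1 - 2 * s) * (ε * hopfBarrier s A B z - η)) := by ring
      _ ≤ _ := by rw [e1]; linarith
  refine (setIntegral_mono_on (hL.integrableOn_compact hT)
    ((hFi.add hR1).const_mul ε).integrableOn hT.measurableSet hpt).trans ?_
  rw [setIntegral_eq_integral_of_forall_compl_eq_zero
    (fun z hz => by simp [hφz z hz, hφ'z z hz]), integral_const_mul]
  refine mul_nonpos_of_nonneg_of_nonpos hε ?_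
  rw [integral_add' hFi hR1, integral_fderiv_hopfFlux s A B hφ.contDiff hc,
    ← integral_add (hRi (fun y => 2 * B * N * y - (2 * s + 1) * A) (by fun_prop)) hR1]
  refine integral_nonpos fun z => ?_
  rw [← add_mul]
  by_cases hz : z ∈ tsupport φ
  · exact mul_nonpos_of_nonpos_of_nonneg (hsub _ (hD z (hφ.tsupport_subset hz))) (hφ0 z)
  · simp [hφz z hz]

/-! ### Growth of the supersolution at the bottom -/

theorem isOpen_hopfCylinder (N : ℕ) (R : ℝ) : IsOpen (hopfCylinder N R) :=
  Metric.isOpen_ball.prod isOpen_Ioo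

theorem closure_hopfCylinder (N : ℕ) {R : ℝ} (hR : 0 < R) :
    closure (hopfCylinder N R) = Metric.closedBall 0 R ×ˢ Icc 0 1 := by
  rw [hopfCylinder, closure_prod_eq, closure_ball _ hR.ne', closure_Ioo zero_ne_one]

/-- A positive weak supersolution grows at least like `y^{2s}` off the bottom of the cylinder. -/
theorem IsWeakSupersolution.exists_mul_rpow_le {N : ℕ} {s m R : ℝ} (hs : 0 < s) (hm : 0 < m)
    (hR : 0 < R) {v : ExtSpace N → ℝ} (hvc : ContinuousOn v (closure (hopfCylinder N R)))
    (hv : IsWeakSupersolution s m (hopfCylinder N R) v)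
    (hpos : ∀ z ∈ hopfCylinder N R, 0 < v z) :
    ∃ ε > 0, ∃ y₀ > 0, ∀ y ∈ Ioo 0 y₀, ε * y ^ (2 * s) ≤ v (0, y) := by
  set r := R / 2 with hr
  have hr0 : 0 < r := by positivity
  -- Choice of constants: `B r² = 2` and `A y₀ ≤ 1` make the barrier nonpositive on `|x| = r`. `Q`
  -- collects the coefficients of `y` in the subsolution condition. Since `m² A y² ≤ A/2`, that
  -- condition follows from `Q y₀ ≤ A/2`, whence `A = 2 Q y₀`.
  set B := 2 / r ^ 2 with hB
  have hB0 : 0 < B := by positivity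
  have hBr : B * r ^ 2 = 2 := by rw [hB]; field_simp
  set Q := 2 * B * N + m ^ 2 with hQ
  have hQ0 : 0 < Q := by positivity
  have hmQ : m ^ 2 ≤ Q := by rw [hQ]; linarith [show 0 ≤ 2 * B * N by positivity]
  set y₀ := 1 / (2 * (1 + Q)) with hy₀
  have hy0 : 0 < y₀ := by positivity
  have hyQ : y₀ * (1 + Q) = 1 / 2 := by rw [hy₀]; field_simp
  have hy1 : y₀ < 1 := by nlinarith
  have hQy : Q * y₀ ^ 2 ≤ 1 / 2 := by nlinarith
  set A := 2 * Q * y₀ with hA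
  have hA0 : 0 < A := by positivity
  have hAy : A * y₀ ≤ 1 := by rw [hA]; linarith
  have hsub : ∀ y ∈ Ioo 0 y₀,
      2 * B * N * y - (2 * s + 1) * A + m ^ 2 * (y + A * y ^ 2) ≤ 0 := by
    intro y hy
    have h1 : m ^ 2 * y ^ 2 ≤ 1 / 2 := by
      calc m ^ 2 * y ^ 2 ≤ Q * y₀ ^ 2 := by
            gcongr
            · exact hy.1.le
            · exact hy.2.le
        _ ≤ _ := hQy
    have h2 := mul_le_mul_of_nonneg_left h1 hA0.le
    have h3 : Q * y ≤ Q * y₀ := by gcongr; exact hy.2.le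
    have h4 : 0 ≤ s * A := by positivity
    have h5 : 2 * B * N * y + m ^ 2 * y = Q * y := by rw [hQ]; ring
    nlinarith
  have hcl := closure_hopfCylinder N hR
  have hvnn : ∀ z ∈ closure (hopfCylinder N R), 0 ≤ v z := by
    intro z hz
    have h1 : v z ∈ closure (v '' hopfCylinder N R) :=
      ContinuousWithinAt.mem_closure_image ((hvc z hz).mono subset_closure) hz
    have h2 : closure (v '' hopfCylinder N R) ⊆ Ici 0 :=
      closure_minimal (by rintro _ ⟨x, hx, rfl⟩; exact (hpos x hx).le) isClosed_Ici
    exact h2 h1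
  have hclc : IsCompact (closure (hopfCylinder N R)) := by
    rw [hcl]; exact (isCompact_closedBall _ _).prod isCompact_Icc
  have hvi : IntegrableOn v (hopfCylinder N R) :=
    (hvc.integrableOn_compact hclc).mono_set subset_closure
  set top : Set (ExtSpace N) := Metric.closedBall 0 r ×ˢ {y₀} with htop
  have htopΩ : top ⊆ hopfCylinder N R := by
    rintro ⟨x, y⟩ ⟨hx, hy⟩
    have hy' : y = y₀ := hy
    rw [hopfCylinder]
    refine ⟨Metric.closedBall_subset_ball (by linarith) hx, ?_⟩
    simp only [hy']
    exact ⟨hy0, hy1⟩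
  obtain ⟨k, hk, hktop⟩ := ((isCompact_closedBall _ _).prod isCompact_singleton :
    IsCompact top).exists_forall_le' (a := 0) (hvc.mono (htopΩ.trans subset_closure))
    (fun z hz => hpos z (htopΩ hz))
  -- The barrier is at most 2 on the lid, where `v ≥ k`.
  refine ⟨k / 2, by positivity, y₀, hy0, fun y hy => ?_⟩
  set ε := k / 2 with hε
  have hε0 : 0 < ε := by positivity
  set D : Set (ExtSpace N) := Metric.ball 0 r ×ˢ Ioo 0 y₀ with hD
  set Q' : Set (ExtSpace N) := Metric.closedBall 0 r ×ˢ Icc 0 y₀ with hQ'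
  have hQ'c : IsCompact Q' := (isCompact_closedBall _ _).prod isCompact_Icc
  have hQ'cl : Q' ⊆ closure (hopfCylinder N R) := by
    rw [hcl]
    exact prod_mono (Metric.closedBall_subset_closedBall (by linarith))
      (Icc_subset_Icc_right hy1.le)
  have hDΩ : D ⊆ hopfCylinder N R :=
    prod_mono (Metric.ball_subset_ball (by linarith)) (Ioo_subset_Ioo_right hy1.le)
  have hDQ' : D ⊆ Q' := prod_mono Metric.ball_subset_closedBall Ioo_subset_Icc_self
  have hDo : IsOpen D := Metric.isOpen_ball.prod isOpen_Ioo
  have hDpos : ∀ z ∈ D, 0 < z.2 := fun z hz => hz.2.1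
  -- Both functions may vanish at the bottom. The shift by `η` keeps the contact set `v ≤ W` compact
  -- inside the open set `D`; afterwards `η` tends to `0`.
  have key : ∀ η > 0, ∀ z ∈ D, ε * hopfBarrier s A B z - η ≤ v z := by
    intro η hη
    have hWc : Continuous fun z : ExtSpace N => ε * hopfBarrier s A B z - η :=
      ((continuous_hopfBarrier hs A B).const_mul ε).sub continuous_const
    have hWd : ∀ z ∈ D, HasFDerivAt (fun z : ExtSpace N => ε * hopfBarrier s A B z - η)
        (ε • ExtSpace.dotCLM (z.2 ^ (2 * s - 1) • hopfFlux s A B z)) z := fun z hz =>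
      ((hasFDerivAt_hopfBarrier s A B (hDpos z hz)).const_mul ε).sub_const η
    have hle : ∀ z ∈ Q', hopfBarrier s A B z ≤ z.2 ^ (2 * s) * (1 - B * ‖z.1‖ ^ 2 + 1) := by
      intro z hz
      have hz2 : 0 ≤ z.2 := hz.2.1
      have h1 : A * z.2 ≤ 1 := le_trans (by gcongr; exact hz.2.2) hAy
      have h2 : z.2 ^ (2 * s + 1) = z.2 ^ (2 * s) * z.2 :=
        Real.rpow_add_one' hz2 (by positivity)
      have h3 : 0 ≤ z.2 ^ (2 * s) := Real.rpow_nonneg hz2 _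
      rw [hopfBarrier, h2]
      nlinarith [mul_le_mul_of_nonneg_left h1 h3]
    refine hv.le_of_subsolution (K := Q' ∩ {z | v z ≤ ε * hopfBarrier s A B z - η})
      (gW := fun z => ε • z.2 ^ (2 * s - 1) • hopfFlux s A B z) hm (isOpen_hopfCylinder N R)
      (fun z hz => hz.2.1) hvi (hvc.mono subset_closure) hDo hDΩ ?_ ?_ ?_ ?_ ?_ ?_ ?_
    · have : IsClosed (Q' ∩ {z | v z ≤ ε * hopfBarrier s A B z - η}) :=
        hQ'c.isClosed.isClosed_le (hvc.mono hQ'cl) hWc.continuousOn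
      exact hQ'c.of_isClosed_subset this inter_subset_left
    · rintro z ⟨hz, hzv⟩
      have hzv' : v z ≤ ε * hopfBarrier s A B z - η := hzv
      have hv0 := hvnn z (hQ'cl hz)
      have hb := hle z hz
      -- As `v ≥ 0`, contact requires a positive barrier. This excludes the bottom and the side; the
      -- lower bound `k` excludes the lid.
      have hbpos : 0 < hopfBarrier s A B z := by
        by_contra! h
        have := mul_nonpos_of_nonneg_of_nonpos hε0.le h
        linarith
      have hz2 : 0 ≤ z.2 := hz.2.1
      have hx : ‖z.1‖ ≤ r := by simpa using hz.1
      have hy0' : z.2 ≠ 0 := by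
        intro h
        rw [h, Real.zero_rpow (by positivity), zero_mul] at hb
        linarith
      have hxr : ‖z.1‖ ≠ r := by
        intro h
        rw [h, hBr] at hb
        have := Real.rpow_nonneg hz2 (2 * s)
        linarith
      have hytop : z.2 ≠ y₀ := by
        intro h
        have h1 := hktop z ⟨hz.1, h⟩
        have h2 : z.2 ^ (2 * s) ≤ 1 :=
          Real.rpow_le_one hz2 (by rw [h]; exact hy1.le) (by positivity)
        have h3 : hopfBarrier s A B z ≤ 2 := by
          have h4 := Real.rpow_nonneg hz2 (2 * s)
          have h5 : 0 ≤ z.2 ^ (2 * s) * (B * ‖z.1‖ ^ 2) := by positivity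
          linarith
        have h6 := mul_le_mul_of_nonneg_left h3 hε0.le
        linarith
      exact ⟨by simpa using lt_of_le_of_ne hx hxr, lt_of_le_of_ne hz2 hy0'.symm,
        lt_of_le_of_ne hz.2.2 hytop⟩
    · refine ContDiffOn.sub (contDiffOn_const.mul ?_) contDiffOn_const
      unfold hopfBarrier
      have h1 : ∀ p : ℝ, ContDiffOn ℝ 1 (fun z : ExtSpace N => z.2 ^ p) D := fun p =>
        contDiffOn_snd.rpow_const_of_ne fun z hz => (hDpos z hz).ne'
      have h2 : ContDiffOn ℝ 1 (fun z : ExtSpace N => ‖z.1‖ ^ 2) D :=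
        (contDiff_fst.norm_sq ℝ).contDiffOn
      exact ((h1 _).mul (contDiffOn_const.sub (contDiffOn_const.mul h2))).add
        (contDiffOn_const.mul (h1 _))
    · exact ((continuousOn_snd_rpow hDpos _).smul
        (continuous_hopfFlux s A B).continuousOn).const_smul ε
    · intro z hz e
      rw [(hWd z hz).fderiv]
      simp [ExtSpace.dotCLM_apply, ExtSpace.dot, inner_smul_left, inner_smul_right,
        real_inner_comm]
      ring
    · intro φ hφ hφ0
      exact hopfBarrier_subsolution hB0.le hε0.le hη.le (isOpen_hopfCylinder N R).measurableSet
        hDΩ (fun z hz => hz.2) hsub hφ hφ0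
    · rintro z ⟨hzD, hzK⟩
      by_contra! h
      exact hzK ⟨hDQ' hzD, h.le⟩
  have hzD : ((0, y) : ExtSpace N) ∈ D := ⟨Metric.mem_ball_self hr0, hy⟩
  have h1 : ε * hopfBarrier s A B ((0, y) : ExtSpace N) ≤ v (0, y) :=
    le_of_forall_pos_le_add fun η hη => by linarith [key η hη _ hzD]
  refine le_trans ?_ h1
  have h2 : 0 ≤ A * y ^ (2 * s + 1) := mul_nonneg hA0.le (Real.rpow_nonneg hy.1.le _)
  gcongr
  simp only [hopfBarrier, norm_zero]
  linarith

/-! ### Hopf lemma -/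

theorem mainTheorem7 {N : ℕ} (hN : 1 ≤ N) {s m R : ℝ} (hs : s ∈ Set.Ioo (0 : ℝ) 1) (hm : 0 < m)
    (hR : 0 < R) (v : ExtSpace N → ℝ)
    (hv_cont : ContinuousOn v (closure (hopfCylinder N R)))
    (hv_super : IsWeakSupersolution s m (hopfCylinder N R) v)
    (hv_pos : ∀ z ∈ hopfCylinder N R, 0 < v z)
    (hv_zero : v (0, 0) = 0) :
    limsup (fun y : ℝ => ((-(y ^ (1 - 2 * s)) * (v (0, y) / y) : ℝ) : EReal)) (𝓝[>] 0) < 0 ∧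
      (WeightedPartialYContinuous s (hopfCylinder N R) v →
        ∃ L : ℝ, HasWeightedNormalDeriv s v 0 L ∧ L < 0) := by
  have hs0 : 0 < s := hs.1
  obtain ⟨ε, hε, y₀, hy₀, H⟩ := hv_super.exists_mul_rpow_le hs0 hm hR hv_cont hv_pos
  have hmem : ∀ y ∈ Ioo (0 : ℝ) 1, ((0, y) : ExtSpace N) ∈ hopfCylinder N R := fun y hy =>
    ⟨Metric.mem_ball_self hR, hy⟩
  have hmemc : ∀ y ∈ Icc (0 : ℝ) 1, ((0, y) : ExtSpace N) ∈ closure (hopfCylinder N R) := by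
    intro y hy
    rw [closure_hopfCylinder N hR]
    exact ⟨Metric.mem_closedBall_self hR.le, hy⟩
  refine ⟨?_, ?_⟩
  · have hev : ∀ᶠ y : ℝ in 𝓝[>] 0,
        ((-(y ^ (1 - 2 * s)) * (v (0, y) / y) : ℝ) : EReal) ≤ ((-ε : ℝ) : EReal) := by
      filter_upwards [Ioo_mem_nhdsGT hy₀] with y hy
      rw [EReal.coe_le_coe_iff, neg_mul, neg_le_neg_iff]
      have e : y ^ (1 - 2 * s) * (ε * y ^ (2 * s) / y) = ε := by
        have : y ^ (1 - 2 * s) * y ^ (2 * s) = y := by rw [← Real.rpow_add hy.1]; simp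
        have hy' := hy.1.ne'
        calc _ = ε * (y ^ (1 - 2 * s) * y ^ (2 * s)) / y := by ring
          _ = ε := by rw [this]; field_simp
      calc ε = y ^ (1 - 2 * s) * (ε * y ^ (2 * s) / y) := e.symm
        _ ≤ _ := by
          have := Real.rpow_nonneg hy.1.le (1 - 2 * s)
          have := hy.1.le
          gcongr
          exact H y hy
    refine (limsup_le_of_le (by isBoundedDefault) hev).trans_lt ?_
    exact_mod_cast neg_neg_of_pos hε
  · rintro ⟨hdiff, g, hg, hgeq⟩
    have hev1 : ∀ᶠ y : ℝ in 𝓝[>] 0, y ∈ Ioo (0 : ℝ) 1 := Ioo_mem_nhdsGT one_pos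
    have hlim : Tendsto (fun y : ℝ => y ^ (1 - 2 * s) * partialY v ((0, y) : ExtSpace N)) (𝓝[>] 0)
        (𝓝 (g (0, 0))) := by
      have h1 : Tendsto (fun y : ℝ => ((0, y) : ExtSpace N)) (𝓝[>] 0)
          (𝓝[closure (hopfCylinder N R)] (0, 0)) := by
        refine tendsto_nhdsWithin_iff.2 ⟨?_, hev1.mono fun y hy => hmemc y ⟨hy.1.le, hy.2.le⟩⟩
        exact ((by fun_prop : Continuous fun y : ℝ => ((0, y) : ExtSpace N)).tendsto 0).mono_left
          nhdsWithin_le_nhds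
      refine ((hg (0, 0) (hmemc 0 ⟨le_rfl, zero_le_one⟩)).tendsto.comp h1).congr' ?_
      exact hev1.mono fun y hy => hgeq _ (hmem y hy)
    refine ⟨-g (0, 0), hlim.neg, ?_⟩
    rw [neg_lt_zero]
    -- As `v(0,0) = 0`, Cauchy's mean value theorem on `[0, y]` writes `v(0,y) / y^{2s}`, which is
    -- at least `ε`, as `ξ^{1-2s} v_y(0,ξ) / (2s)` with `0 < ξ < y`. A limit below `2sε` would
    -- contradict this for small `y`.
    have hge : 2 * s * ε ≤ g (0, 0) := by
      by_contra! hlt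
      obtain ⟨δ, hδ, hδlt⟩ := mem_nhdsGT_iff_exists_Ioo_subset.1
        (hlim.eventually (eventually_lt_nhds hlt))
      set y := min (y₀ / 2) (min (δ / 2) (1 / 2)) with hy
      have hδ' : 0 < δ := hδ
      have hypos : 0 < y := by positivity
      have hyy₀ : y < y₀ := (min_le_left _ _).trans_lt (by linarith)
      have hyδ : y < δ := ((min_le_right _ _).trans (min_le_left _ _)).trans_lt (by linarith)
      have hy1 : y < 1 := ((min_le_right _ _).trans (min_le_right _ _)).trans_lt (by norm_num)
      have hvc : ContinuousOn (fun t : ℝ => v ((0, t) : ExtSpace N)) (Icc 0 y) :=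
        hv_cont.comp (by fun_prop) fun t ht => hmemc t ⟨ht.1, ht.2.trans hy1.le⟩
      have hpc : ContinuousOn (fun t : ℝ => t ^ (2 * s)) (Icc 0 y) :=
        continuousOn_id.rpow_const fun t _ => Or.inr (by positivity)
      obtain ⟨ξ, hξ, e⟩ := exists_ratio_hasDerivAt_eq_ratio_slope
        (fun t : ℝ => v ((0, t) : ExtSpace N)) (fun t => partialY v ((0, t) : ExtSpace N)) hypos
        hvc (fun t ht => (hdiff _ (hmem t ⟨ht.1, ht.2.trans hy1⟩)).hasDerivAt)
        (fun t : ℝ => t ^ (2 * s)) (fun t => 2 * s * t ^ (2 * s - 1)) hpc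
        (fun t ht => Real.hasDerivAt_rpow_const (Or.inl ht.1.ne'))
      simp only [hv_zero, sub_zero] at e
      rw [Real.zero_rpow (by positivity), sub_zero] at e
      have hξlt : ξ ^ (1 - 2 * s) * partialY v ((0, ξ) : ExtSpace N) < 2 * s * ε :=
        hδlt ⟨hξ.1, hξ.2.trans hyδ⟩
      have e1 : ξ ^ (1 - 2 * s) * ξ ^ (2 * s - 1) = 1 := by
        rw [← Real.rpow_add hξ.1]; simp
      have hyp : 0 < y ^ (2 * s) := Real.rpow_pos_of_pos hypos _
      have e2 : y ^ (2 * s) * (ξ ^ (1 - 2 * s) * partialY v ((0, ξ) : ExtSpace N)) =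
          2 * s * v (0, y) := by
        calc _ = ξ ^ (1 - 2 * s) * (y ^ (2 * s) * partialY v ((0, ξ) : ExtSpace N)) := by ring
          _ = (ξ ^ (1 - 2 * s) * ξ ^ (2 * s - 1)) * (2 * s * v (0, y)) := by rw [e]; ring
          _ = _ := by rw [e1, one_mul]
      have h1 := mul_lt_mul_of_pos_left hξlt hyp
      have h2 := mul_le_mul_of_nonneg_left (H y ⟨hypos, hyy₀⟩) (show 0 ≤ 2 * s by positivity)
      linarith
    exact lt_of_lt_of_le (by positivity) hge
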